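/- Let $F:S^1\to S^1$ be a Morse–Smale $C^r$ diffeomorphism of the circle, $r\ge 1$: its nonwandering set $\Omega(F)$ consists of finitely many hyperbolic periodic points, and the stable and unstable manifolds of the periodic points are pairwise transversal. Let $\mathcal M(S^1)$ be the space of Borel probability measures on $S^1$ with the weak-$*$ topology, and let $F_*:\mathcal M(S^1)\to\mathcal M(S^1)$, $F_*\mu=\mu\circ F^{-1}$. Then $$o(F_*)=\sup\{[n^t] : t\in(0,\infty)\}.$$ Here an order of growth $[a(n)]$ is the class of a non-decreasing sequence $a:\{1,2,3,\dots\}\to[0,\infty)$ under the relation $a\approx b$ if and only if $c\,a(n)\le b(n)\le C\,a(n)$ for all $n$, for some constants $c,C>0$. These classes are ordered by $[a(n)]\le[b(n)]$ if and only if there is $C>0$ with $a(n)\le C\,b(n)$ for all $n$. Suprema are taken in the Dedekind–MacNeille completion $\overline{\mathbb O}$ of the partially ordered set $\mathbb O$ of orders of growth. For a continuous self-map $T$ of a compact metric space $(X,d)$, the generalized entropy of $T$ is $$o(T)=\sup\{[\mathrm{Span}(T,n,\varepsilon)] : \varepsilon>0\}\in\overline{\mathbb O},$$ where $\mathrm{Span}(T,n,\varepsilon)$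 is the least cardinality of a set $E\subset X$ such that every $x\in X$ has some $y\in E$ with $\max_{0\le i<n}d(T^ix,T^iy)<\varepsilon$. The equality holds when $o(F_*)$ is computed with any metric on $\mathcal M(S^1)$ that induces the weak-$*$ topology. -/

import Mathlib

open Set Filter Topology MeasureTheory
open scoped NNReal Manifold ContDiff

noncomputable section

/-! ## Orders of growth -/

/-- Non-decreasing sequences `a : {1, 2, 3, …} → [0, ∞)`. -/
structure GrowthSeq where
  /-- the underlying sequence -/
  toFun : ℕ+ → ℝ≥0
  /-- the sequence is non-decreasing -/
  monotone' : Monotone toFun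

/-- `a ≤ b` if there is `C > 0` with `a n ≤ C * b n` for all `n`. -/
instance : Preorder GrowthSeq where
  le a b := ∃ C : ℝ≥0, 0 < C ∧ ∀ n, a.toFun n ≤ C * b.toFun n
  le_refl a := ⟨1, one_pos, fun n => by simp⟩
  le_trans a b c := by
    rintro ⟨C, hC, h⟩ ⟨D, hD, k⟩
    refine ⟨C * D, mul_pos hC hD, fun n => (h n).trans ?_⟩
    rw [mul_assoc]
    gcongr
    exact k n

theorem GrowthSeq.le_iff (a b : GrowthSeq) :
    a ≤ b ↔ ∃ C : ℝ≥0, 0 < C ∧ ∀ n, a.toFun n ≤ C * b.toFun n := Iff.rfl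

/-- Two sequences have the same order of growth if
`c * a n ≤ b n ≤ C * a n` for all `n`, with constants `c, C > 0`. -/
instance GrowthSeq.setoid : Setoid GrowthSeq where
  r a b := ∃ c C : ℝ≥0, 0 < c ∧ 0 < C ∧
    ∀ n, c * a.toFun n ≤ b.toFun n ∧ b.toFun n ≤ C * a.toFun n
  iseqv := by
    have key : ∀ a b : GrowthSeq, (∃ c C : ℝ≥0, 0 < c ∧ 0 < C ∧
        ∀ n, c * a.toFun n ≤ b.toFun n ∧ b.toFun n ≤ C * a.toFun n) ↔ a ≤ b ∧ b ≤ a := by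
      intro a b
      constructor
      · rintro ⟨c, C, hc, hC, h⟩
        refine ⟨⟨c⁻¹, inv_pos.2 hc, fun n => ?_⟩, ⟨C, hC, fun n => (h n).2⟩⟩
        calc a.toFun n = c⁻¹ * (c * a.toFun n) := by
              rw [← mul_assoc, inv_mul_cancel₀ hc.ne', one_mul]
          _ ≤ c⁻¹ * b.toFun n := by
              gcongr
              exact (h n).1
      · rintro ⟨⟨D, hD, h⟩, ⟨C, hC, k⟩⟩
        refine ⟨D⁻¹, C, inv_pos.2 hD, hC, fun n => ⟨?_, k n⟩⟩
        calc D⁻¹ * a.toFun n ≤ D⁻¹ * (D * b.toFun n) := by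
              gcongr
              exact h n
          _ = b.toFun n := by rw [← mul_assoc, inv_mul_cancel₀ hD.ne', one_mul]
    refine ⟨fun a => (key a a).2 ⟨le_rfl, le_rfl⟩, fun {a b} h => ?_, fun {a b c} h k => ?_⟩
    · exact (key b a).2 ((key a b).1 h).symm
    · exact (key a c).2 ⟨((key a b).1 h).1.trans ((key b c).1 k).1,
        ((key b c).1 k).2.trans ((key a b).1 h).2⟩

theorem GrowthSeq.equiv_iff (a b : GrowthSeq) : a ≈ b ↔ a ≤ b ∧ b ≤ a := by
  constructor
  · rintro ⟨c, C, hc, hC, h⟩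
    refine ⟨⟨c⁻¹, inv_pos.2 hc, fun n => ?_⟩, ⟨C, hC, fun n => (h n).2⟩⟩
    calc a.toFun n = c⁻¹ * (c * a.toFun n) := by
          rw [← mul_assoc, inv_mul_cancel₀ hc.ne', one_mul]
      _ ≤ c⁻¹ * b.toFun n := by
          gcongr
          exact (h n).1
  · rintro ⟨⟨D, hD, h⟩, ⟨C, hC, k⟩⟩
    refine ⟨D⁻¹, C, inv_pos.2 hD, hC, fun n => ⟨?_, k n⟩⟩
    calc D⁻¹ * a.toFun n ≤ D⁻¹ * (D * b.toFun n) := by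
          gcongr
          exact h n
      _ = b.toFun n := by rw [← mul_assoc, inv_mul_cancel₀ hD.ne', one_mul]

/-- The space of orders of growth: non-decreasing sequences up to `≈`. -/
def GrowthOrder : Type := Quotient GrowthSeq.setoid

/-- The class `[a(n)]`. -/
def GrowthOrder.mk (a : GrowthSeq) : GrowthOrder := Quotient.mk GrowthSeq.setoid a

instance : PartialOrder GrowthOrder where
  le := Quotient.lift₂ (fun a b : GrowthSeq => a ≤ b) (by
    intro a b a' b' h k
    have h' := (GrowthSeq.equiv_iff _ _).1 h
    have k' := (GrowthSeq.equiv_iff _ _).1 k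
    exact propext ⟨fun l => (h'.2.trans l).trans k'.1, fun l => (h'.1.trans l).trans k'.2⟩)
  le_refl a := by
    induction a using Quotient.inductionOn
    exact le_refl (α := GrowthSeq) _
  le_trans a b c := by
    induction a using Quotient.inductionOn
    induction b using Quotient.inductionOn
    induction c using Quotient.inductionOn
    exact le_trans (α := GrowthSeq)
  le_antisymm a b := by
    induction a using Quotient.inductionOn
    induction b using Quotient.inductionOn
    exact fun h k => Quotient.sound ((GrowthSeq.equiv_iff _ _).2 ⟨h, k⟩)

theorem GrowthOrder.mk_le_mk (a b : GrowthSeq) :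
    GrowthOrder.mk a ≤ GrowthOrder.mk b ↔ a ≤ b := Iff.rfl

/-- The complete space of orders of growth: the Dedekind–MacNeille completion of `GrowthOrder`.
It is a complete lattice, and `DedekindCut.principal` is the inclusion of `GrowthOrder`. -/
abbrev CompleteGrowthOrder : Type := DedekindCut GrowthOrder

/-- The sequence `n ↦ n ^ t`, for real `t > 0`. -/
def polySeq (t : ℝ) (ht : 0 < t) : GrowthSeq where
  toFun n := (n : ℝ≥0) ^ t
  monotone' m n h := NNReal.rpow_le_rpow (by exact_mod_cast h) ht.le

/-- The family of polynomial orders of growth, `{[n ^ t] : t > 0}`. -/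
def polynomialOrders : Set GrowthOrder :=
  {o | ∃ (t : ℝ) (ht : 0 < t), o = GrowthOrder.mk (polySeq t ht)}

/-! ## Generalized entropy -/

section Entropy

variable {X : Type*} [MetricSpace X]

/-- The dynamical distance `d_n(x, y) = max {d (T^i x) (T^i y) : 0 ≤ i < n}`. -/
def dynDist (T : X → X) (n : ℕ+) (x y : X) : ℝ :=
  (Finset.range n).sup' (Finset.nonempty_range_iff.2 n.ne_zero)
    (fun i => dist (T^[i] x) (T^[i] y))

/-- `E` is an `(n, ε)`-spanning set for `T`. -/
def IsSpanningSet (T : X → X) (n : ℕ+) (ε : ℝ) (E : Set X) : Prop :=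
  ∀ x, ∃ y ∈ E, dynDist T n x y < ε

/-- `Span(T, n, ε)`: the minimal cardinality of a finite `(n, ε)`-spanning set. -/
def spanNumber (T : X → X) (n : ℕ+) (ε : ℝ) : ℕ :=
  sInf {k | ∃ E : Finset X, IsSpanningSet T n ε (E : Set X) ∧ E.card = k}

theorem dynDist_lt_iff (T : X → X) (n : ℕ+) (x y : X) (ε : ℝ) :
    dynDist T n x y < ε ↔ ∀ i < (n : ℕ), dist (T^[i] x) (T^[i] y) < ε := by
  simp [dynDist, Finset.sup'_lt_iff]

theorem exists_spanningSet [CompactSpace X] (T : C(X, X)) (n : ℕ+) {ε : ℝ} (hε : 0 < ε) :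
    ∃ E : Finset X, IsSpanningSet T n ε (E : Set X) := by
  have hopen : ∀ y : X, IsOpen {x | dynDist T n x y < ε} := by
    intro y
    have : {x | dynDist T n x y < ε} =
        ⋂ i ∈ Finset.range n, {x | dist (T^[i] x) (T^[i] y) < ε} := by
      ext x
      simp [dynDist_lt_iff]
    rw [this]
    exact isOpen_biInter_finset fun i _ =>
      isOpen_lt ((T.continuous.iterate i).dist continuous_const) continuous_const
  obtain ⟨E, hE⟩ := isCompact_univ.elim_finite_subcover _ hopen (fun x _ => by
    refine mem_iUnion.2 ⟨x, ?_⟩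
    simp [dynDist_lt_iff, hε])
  refine ⟨E, fun x => ?_⟩
  obtain ⟨y, hy, hxy⟩ := mem_iUnion₂.1 (hE (mem_univ x))
  exact ⟨y, hy, hxy⟩

theorem spanNumber_mono [CompactSpace X] (T : C(X, X)) {ε : ℝ} (hε : 0 < ε) :
    Monotone fun n : ℕ+ => (spanNumber T n ε : ℝ≥0) := by
  intro m n h
  obtain ⟨E₀, hE₀⟩ := exists_spanningSet T n hε
  obtain ⟨E, hE, hc⟩ := Nat.sInf_mem
    (s := {k | ∃ E : Finset X, IsSpanningSet T n ε (E : Set X) ∧ E.card = k}) ⟨_, E₀, hE₀, rfl⟩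
  have : spanNumber T m ε ≤ spanNumber T n ε := by
    refine Nat.sInf_le ⟨E, fun x => ?_, hc⟩
    obtain ⟨y, hy, hxy⟩ := hE x
    refine ⟨y, hy, (dynDist_lt_iff ..).2 fun i hi => (dynDist_lt_iff ..).1 hxy i ?_⟩
    exact lt_of_lt_of_le hi (by exact_mod_cast h)
  exact Nat.cast_le.2 this

/-- The sequence `n ↦ Span(T, n, ε)`. -/
def spanSeq [CompactSpace X] (T : C(X, X)) (ε : ℝ) (hε : 0 < ε) : GrowthSeq where
  toFun n := spanNumber T n ε
  monotone' := spanNumber_mono T hε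

/-- The generalized entropy `o(T) = sup {[Span(T, n, ε)] : ε > 0}` of a continuous self-map of a
compact metric space, in the completed space of orders of growth. -/
def generalizedEntropy [CompactSpace X] (T : C(X, X)) : CompleteGrowthOrder :=
  sSup (DedekindCut.principal ''
    {o : GrowthOrder | ∃ (ε : ℝ) (hε : 0 < ε), o = GrowthOrder.mk (spanSeq T ε hε)})

end Entropy

/-- A metric on a topological space that induces the given topology. -/
structure CompatibleMetric (X : Type*) [t : TopologicalSpace X] where
  /-- the metric -/
  metric : MetricSpace X
  /-- its topology is the given one -/
  compatible : t = metric.toPseudoMetricSpace.toUniformSpace.toTopologicalSpace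

/-- The metric space structure, whose topology is the given one by definition. -/
abbrev CompatibleMetric.toMetricSpace {X : Type*} [TopologicalSpace X] (d : CompatibleMetric X) :
    MetricSpace X :=
  d.metric.replaceTopology d.compatible

instance {X : Type*} [TopologicalSpace X] [TopologicalSpace.MetrizableSpace X] :
    Nonempty (CompatibleMetric X) :=
  ⟨⟨TopologicalSpace.metrizableSpaceMetric X, rfl⟩⟩

/-- The generalized entropy of a continuous self-map of a compact metrizable space, computed with
the compatible metric `d`. -/
def generalizedEntropyWith {X : Type*} [TopologicalSpace X] [CompactSpace X]
    (d : CompatibleMetric X) (T : C(X, X)) : CompleteGrowthOrder :=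
  letI := d.toMetricSpace
  generalizedEntropy T

/-! ## The measure-induced map -/

/-- The push-forward map `μ ↦ μ ∘ T⁻¹` on Borel probability measures, with the weak topology. -/
def measureInduced {X : Type*} [TopologicalSpace X] [MeasurableSpace X] [BorelSpace X]
    (T : C(X, X)) : C(ProbabilityMeasure X, ProbabilityMeasure X) where
  toFun μ := μ.map T.continuous.measurable.aemeasurable
  continuous_toFun := ProbabilityMeasure.continuous_map T.continuous

/-! ## Morse–Smale diffeomorphisms of the circle -/

instance : MeasurableSpace Circle := borel Circle

instance : BorelSpace Circle := ⟨rfl⟩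

/-- The set of nonwandering points. -/
def nonwanderingSet {X : Type*} [TopologicalSpace X] (T : X → X) : Set X :=
  {x | ∀ U ∈ 𝓝 x, ∃ n : ℕ, 0 < n ∧ (T^[n] '' U ∩ U).Nonempty}

/-- `p` is a hyperbolic periodic point of `F`: it is periodic, with minimal period `k ≥ 1`, and no
eigenvalue of the derivative of `F^k` at `p` has modulus one. The tangent space at `p` is a real
line, so all eigenvalues are real. (The derivative maps to the tangent space at `F^k p = p`.) -/
def IsHyperbolicPeriodicPt (F : Circle → Circle) (p : Circle) : Prop :=
  p ∈ Function.periodicPts F ∧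
    ∀ c : ℝ, Module.End.HasEigenvalue (R := ℝ) (M := TangentSpace (𝓡 1) p)
      (mfderiv (𝓡 1) (𝓡 1) (F^[Function.minimalPeriod F p]) p).toLinearMap c → |c| ≠ 1

/-- The stable manifold of `p` for `F`, as a set. -/
def stableManifold (F : Circle → Circle) (p : Circle) : Set Circle :=
  {x | Tendsto (fun n : ℕ => dist (F^[n] x) (F^[n] p)) atTop (𝓝 0)}

/-- The tangent space at `x` of a submanifold `W` of the circle, spanned by the velocities of the
`C¹` curves in `W` through `x`. -/
def tangentSpaceOf (W : Set Circle) (x : Circle) : Submodule ℝ (TangentSpace (𝓡 1) x) :=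
  Submodule.span ℝ {v | ∃ γ : ℝ → Circle, ContMDiff 𝓘(ℝ, ℝ) (𝓡 1) 1 γ ∧ (∀ s, γ s ∈ W) ∧
    γ 0 = x ∧ v = mfderiv 𝓘(ℝ, ℝ) (𝓡 1) γ 0 (1 : ℝ)}

/-- A `C^r` diffeomorphism of the circle is Morse–Smale if its nonwandering set consists of
finitely many hyperbolic periodic points, and stable and unstable manifolds of periodic points
(the latter being the stable manifolds for the inverse) meet transversally. -/
structure IsMorseSmale {r : ℕ∞ω} (F : Diffeomorph (𝓡 1) (𝓡 1) Circle Circle r) : Prop where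
  finite_nonwandering : (nonwanderingSet F).Finite
  hyperbolic : ∀ p ∈ nonwanderingSet F, IsHyperbolicPeriodicPt F p
  transverse : ∀ p ∈ Function.periodicPts F, ∀ q ∈ Function.periodicPts F,
    ∀ x ∈ stableManifold F p ∩ stableManifold F.symm q,
      tangentSpaceOf (stableManifold F p) x ⊔ tangentSpaceOf (stableManifold F.symm q) x = ⊤

/-- The continuous map underlying a diffeomorphism of the circle. -/
def Diffeomorph.toCircleMap {r : ℕ∞ω} (F : Diffeomorph (𝓡 1) (𝓡 1) Circle Circle r) :
    C(Circle, Circle) := ⟨F, F.continuous⟩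

end

open scoped ENNReal BoundedContinuousFunction

/-! Call a set biconnected if it and its complement are connected. A homeomorphism `F` of the circle
permutes the biconnected sets, so it preserves the discrepancy of two measures over them. Every
measure is within discrepancy `1 / M` of the empirical measure of `M` points, its `M`-quantiles with
respect to the argument. Small discrepancy forces a small distance, so this approximation persists
along the whole orbit of the measure. Since the circle has `(n, δ)`-spanning sets for `F` of
cardinality at most `K n`, moving the `M` points into such a set gives `(n, ε)`-spanning sets of
cardinality at most `(K n) ^ M` for `F_*`.

For the lower bound, a wandering point has an orbit `(y m)` and a bump function `f` with
`f (F^[i] (y m))` equal to `1` if `i = m` and to `0` otherwise. Given `a₀, …, aₖ₋₁ < n`, the measure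
with mass proportional to `2 ^ j` at `y (a j)` can be read off from the integrals of `f` along its
orbit up to time `n`, because binary expansions are unique. These `n ^ k` measures are
`(n, ε)`-separated for an `ε` that does not depend on `n`.
-/

/-! ## Arcs and the argument -/

/-- A set that is connected together with its complement. In the circle these are the arcs, the
empty set and the whole circle included. This class of test sets for comparing measures is defined
by topology alone and hence invariant under homeomorphisms. -/
def IsBiconnected {X : Type*} [TopologicalSpace X] (A : Set X) : Prop :=
  IsPreconnected A ∧ IsPreconnected Aᶜ

theorem IsBiconnected.preimage {X Y : Type*} [TopologicalSpace X] [TopologicalSpace Y]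
    {A : Set Y} (hA : IsBiconnected A) (F : X ≃ₜ Y) : IsBiconnected (F ⁻¹' A) :=
  ⟨F.isPreconnected_preimage.2 hA.1, F.isPreconnected_preimage.2 hA.2⟩

/-- The principal argument on the unit circle, with values in `(-π, π]`: the coordinate that turns
arcs into intervals. It is discontinuous at `Circle.exp π` only. -/
noncomputable def circleArg (z : Circle) : ℝ := Complex.arg z

theorem exp_circleArg (z : Circle) : Circle.exp (circleArg z) = z := Circle.exp_arg z

theorem circleArg_exp {t : ℝ} (ht : t ∈ Ioc (-Real.pi) Real.pi) : circleArg (Circle.exp t) = t :=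
  Circle.arg_exp ht.1 ht.2

theorem circleArg_mem_Ioc (z : Circle) : circleArg z ∈ Ioc (-Real.pi) Real.pi :=
  Complex.arg_mem_Ioc z

theorem measurable_circleArg : Measurable circleArg :=
  Complex.measurable_arg.comp
    (Continuous.measurable (f := fun z : Circle => (z : ℂ)) continuous_subtype_val)

theorem continuousOn_circleArg : ContinuousOn circleArg {Circle.exp Real.pi}ᶜ := by
  intro z hz
  refine (ContinuousAt.comp (f := fun z : Circle => (z : ℂ)) (Complex.continuousAt_arg ?_)
    continuous_subtype_val.continuousAt).continuousWithinAt
  refine Complex.mem_slitPlane_iff_arg.2 ⟨fun h => hz ?_, Circle.coe_ne_zero z⟩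
  rw [mem_singleton_iff, ← exp_circleArg z, circleArg, h]

theorem ordConnected_circleArg_image {C : Set Circle} (hC : IsPreconnected C)
    (hπ : Circle.exp Real.pi ∉ C) : (circleArg '' C).OrdConnected :=
  (hC.image _ (continuousOn_circleArg.mono (subset_compl_singleton_iff.2 hπ))).ordConnected

theorem isPreconnected_circleArg_preimage {I : Set ℝ} (hI : I.OrdConnected) :
    IsPreconnected (circleArg ⁻¹' I) := by
  have : circleArg ⁻¹' I = Circle.exp '' (I ∩ Ioc (-Real.pi) Real.pi) := by
    ext z
    constructor
    · exact fun hz => ⟨circleArg z, ⟨hz, circleArg_mem_Ioc z⟩, exp_circleArg z⟩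
    · rintro ⟨t, ⟨htI, ht⟩, rfl⟩
      rwa [mem_preimage, circleArg_exp ht]
  rw [this]
  exact (hI.inter ordConnected_Ioc).isPreconnected.image _ Circle.exp.continuous.continuousOn

/-- The intersection on the right is an interval, so the complement is again an arc. -/
theorem compl_circleArg_preimage {J : Set ℝ} (hJ : J.OrdConnected)
    (hJπ : J ⊆ Ioc (-Real.pi) Real.pi) :
    (circleArg ⁻¹' J)ᶜ = Circle.exp '' ⋂ s ∈ J, Ioo s (s + 2 * Real.pi) := by
  ext z
  simp only [mem_compl_iff, mem_preimage, mem_image, mem_iInter, mem_Ioo]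
  constructor
  · intro hz
    obtain ⟨hz₁, hz₂⟩ := circleArg_mem_Ioc z
    by_cases habove : ∀ s ∈ J, s < circleArg z
    · exact ⟨circleArg z, fun s hs => ⟨habove s hs, by linarith [(hJπ hs).1]⟩, exp_circleArg z⟩
    · push Not at habove
      obtain ⟨s₀, hs₀, hzs₀⟩ := habove
      have hbelow : ∀ s ∈ J, circleArg z < s := fun s hs =>
        not_le.1 fun hsz => hz (hJ.out hs hs₀ ⟨hsz, hzs₀⟩)
      refine ⟨circleArg z + 2 * Real.pi, fun s hs => ⟨by linarith [(hJπ hs).2], ?_⟩, ?_⟩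
      · linarith [hbelow s hs]
      · rw [Circle.exp_add_two_pi, exp_circleArg]
  · rintro ⟨t, ht, rfl⟩ hs
    obtain ⟨m, hm⟩ := Circle.exp_eq_exp.1 (exp_circleArg (Circle.exp t))
    obtain ⟨hs₁, hs₂⟩ := ht _ hs
    have hm₁ : (-1 : ℝ) < m := by nlinarith [Real.pi_pos]
    have hm₂ : (m : ℝ) < 0 := by nlinarith [Real.pi_pos]
    norm_cast at hm₁ hm₂
    lia

theorem isBiconnected_circleArg_preimage {I : Set ℝ} (hI : I.OrdConnected) :
    IsBiconnected (circleArg ⁻¹' I) := by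
  refine ⟨isPreconnected_circleArg_preimage hI, ?_⟩
  have hJ : circleArg ⁻¹' I = circleArg ⁻¹' (I ∩ Ioc (-Real.pi) Real.pi) := by
    ext z
    simp only [mem_preimage, mem_inter_iff, circleArg_mem_Ioc, and_true]
  rw [hJ, compl_circleArg_preimage (hI.inter ordConnected_Ioc) inter_subset_right]
  exact (ordConnected_biInter fun _ _ => ordConnected_Ioo).isPreconnected.image _
    Circle.exp.continuous.continuousOn

theorem IsBiconnected.exists_circleArg_preimage {A : Set Circle} (hA : IsBiconnected A) :
    ∃ I : Set ℝ, I.OrdConnected ∧ (circleArg ⁻¹' I = A ∨ circleArg ⁻¹' I = Aᶜ) := by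
  have hinj : Function.Injective circleArg := Function.LeftInverse.injective exp_circleArg
  by_cases hπ : Circle.exp Real.pi ∈ A
  · exact ⟨_, ordConnected_circleArg_image hA.2 (not_not_intro hπ),
      Or.inr (preimage_image_eq _ hinj)⟩
  · exact ⟨_, ordConnected_circleArg_image hA.1 hπ, Or.inl (preimage_image_eq _ hinj)⟩

theorem IsBiconnected.measurableSet {A : Set Circle} (hA : IsBiconnected A) :
    MeasurableSet A := by
  obtain ⟨I, hI, hIA | hIA⟩ := hA.exists_circleArg_preimage
  · exact hIA ▸ measurable_circleArg hI.measurableSet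
  · exact MeasurableSet.compl_iff.1 (hIA ▸ measurable_circleArg hI.measurableSet)

theorem dist_circle_exp_le (s t : ℝ) : dist (Circle.exp s) (Circle.exp t) ≤ |s - t| := by
  have hst : (Circle.exp s : ℂ) - Circle.exp t =
      Circle.exp t * (Complex.exp (Complex.I * (s - t : ℝ)) - 1) := by
    rw [mul_comm Complex.I, ← Circle.coe_exp, mul_sub, ← Circle.coe_mul, ← Circle.exp_add,
      add_sub_cancel, mul_one]
  change dist (Circle.exp s : ℂ) (Circle.exp t) ≤ _
  rw [dist_eq_norm, hst, norm_mul, Circle.norm_coe, one_mul]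
  exact Real.norm_exp_I_mul_ofReal_sub_one_le

/-- The least multiple of `h` that is at least `t`, the analogue of `Int.ceil` for the grid `hℤ`. -/
noncomputable def gridCeil (h t : ℝ) : ℝ := ⌈t / h⌉ * h

theorem gridCeil_mem_Ico {h : ℝ} (hh : 0 < h) (t : ℝ) : gridCeil h t ∈ Ico t (t + h) := by
  rw [gridCeil, mem_Ico, ← div_le_iff₀ hh, ← lt_div_iff₀ hh, add_div, div_self hh.ne']
  exact ⟨Int.le_ceil _, Int.ceil_lt_add_one _⟩

theorem gridCeil_mono {h : ℝ} (hh : 0 < h) : Monotone (gridCeil h) := fun s t hst => by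
  unfold gridCeil
  gcongr

theorem gridCeil_intCast_mul {h : ℝ} (hh : 0 < h) (m : ℤ) : gridCeil h (m * h) = m * h := by
  rw [gridCeil, mul_div_cancel_right₀ _ hh.ne', Int.ceil_intCast]

theorem gridCeil_eq_of_notMem_Icc {h s t : ℝ} (hh : 0 < h) (hst : s ≤ t)
    (hs : gridCeil h s ∉ Icc s t) : gridCeil h s = gridCeil h t := by
  have hts : t ≤ gridCeil h s :=
    (not_le.1 fun h' => hs ⟨(gridCeil_mem_Ico hh s).1, h'⟩).le
  refine (gridCeil_mono hh hst).antisymm ((gridCeil_mono hh hts).trans_eq ?_)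
  exact gridCeil_intCast_mul hh _

/-- Rounds the argument up to the next multiple of `π / (N + 1)`. Since `π` is itself such a
multiple, this moves no point across the cut of the argument. -/
noncomputable def circleRound (N : ℕ) (z : Circle) : Circle :=
  Circle.exp (gridCeil (Real.pi / (N + 1)) (circleArg z))

section circleRound

variable (N : ℕ)

theorem gridCeil_pi : gridCeil (Real.pi / (N + 1)) Real.pi = Real.pi := by
  have hN : ((N + 1 : ℤ) : ℝ) * (Real.pi / (N + 1)) = Real.pi := by
    push_cast
    field_simp
  simpa only [hN] using gridCeil_intCast_mul (h := Real.pi / (N + 1)) (by positivity) (N + 1)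

theorem circleArg_circleRound (z : Circle) :
    circleArg (circleRound N z) = gridCeil (Real.pi / (N + 1)) (circleArg z) := by
  have hh : 0 < Real.pi / (N + 1) := by positivity
  refine circleArg_exp ⟨?_, ?_⟩
  · exact (circleArg_mem_Ioc z).1.trans_le (gridCeil_mem_Ico hh _).1
  · exact (gridCeil_mono hh (circleArg_mem_Ioc z).2).trans_eq (gridCeil_pi N)

theorem finite_range_circleRound : (range (circleRound N)).Finite := by
  have hh : 0 < Real.pi / (N + 1) := by positivity
  set h := Real.pi / (N + 1)
  refine ((finite_Icc ⌈-Real.pi / h⌉ ⌈Real.pi / h⌉).image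
    fun m : ℤ => Circle.exp (m * h)).subset ?_
  rintro _ ⟨z, rfl⟩
  obtain ⟨hz₁, hz₂⟩ := circleArg_mem_Ioc z
  exact ⟨⌈circleArg z / h⌉, ⟨by gcongr, by gcongr⟩, rfl⟩

theorem isBiconnected_circleRound_fiber (w : Circle) :
    IsBiconnected (circleRound N ⁻¹' {w}) := by
  have hw : circleRound N ⁻¹' {w} =
      circleArg ⁻¹' (gridCeil (Real.pi / (N + 1)) ⁻¹' {circleArg w}) := by
    ext z
    rw [mem_preimage, mem_preimage, mem_preimage, mem_singleton_iff, mem_singleton_iff,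
      ← circleArg_circleRound]
    exact (Function.LeftInverse.injective exp_circleArg).eq_iff.symm
  rw [hw]
  exact isBiconnected_circleArg_preimage
    (ordConnected_singleton.preimage_mono (gridCeil_mono (by positivity)))

theorem circleRound_eq_of_isPreconnected {C : Set Circle} (hC : IsPreconnected C)
    (hCN : Disjoint C (range (circleRound N))) {x y : Circle} (hx : x ∈ C) (hy : y ∈ C) :
    circleRound N x = circleRound N y := by
  wlog hxy : circleArg x ≤ circleArg y generalizing x y
  · exact (this hy hx (le_of_not_ge hxy)).symm
  have hπ : circleRound N (Circle.exp Real.pi) = Circle.exp Real.pi := by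
    rw [circleRound, circleArg_exp ⟨by linarith [Real.pi_pos], le_rfl⟩, gridCeil_pi]
  have hI := ordConnected_circleArg_image hC
    fun hπC => disjoint_left.1 hCN hπC ⟨_, hπ⟩
  refine congrArg Circle.exp (gridCeil_eq_of_notMem_Icc (by positivity) hxy fun hmem => ?_)
  obtain ⟨w, hwC, hw⟩ := hI.out (mem_image_of_mem _ hx) (mem_image_of_mem _ hy) hmem
  refine disjoint_left.1 hCN hwC ⟨x, ?_⟩
  rw [← exp_circleArg w, hw, circleRound]

end circleRound

theorem exists_forall_dist_circleRound_lt {ε : ℝ} (hε : 0 < ε) :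
    ∃ N, ∀ z, dist (circleRound N z) z < ε := by
  obtain ⟨N, hN⟩ := exists_nat_gt (Real.pi / ε)
  refine ⟨N, fun z => ?_⟩
  obtain ⟨hl, hu⟩ := gridCeil_mem_Ico (show 0 < Real.pi / (N + 1) by positivity) (circleArg z)
  calc dist (circleRound N z) z = dist (circleRound N z) (Circle.exp (circleArg z)) := by
        rw [exp_circleArg]
    _ ≤ |gridCeil (Real.pi / (N + 1)) (circleArg z) - circleArg z| := dist_circle_exp_le _ _
    _ ≤ Real.pi / (N + 1) := abs_le.2 ⟨by linarith, by linarith⟩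
    _ < ε := by
        rw [div_lt_comm₀ (by positivity) hε]
        linarith

/-! ## Spanning sets of circle homeomorphisms -/

theorem exists_mem_closure_connectedComponentIn_compl {X : Type*} [TopologicalSpace X]
    [PreconnectedSpace X] [LocallyConnectedSpace X] {E : Set X} (hE : IsClosed E)
    (hne : E.Nonempty) {x : X} (hx : x ∉ E) :
    ∃ y ∈ E, y ∈ closure (connectedComponentIn Eᶜ x) := by
  set C := connectedComponentIn Eᶜ x
  have hxC : x ∈ C := mem_connectedComponentIn hx
  have hCE : C ⊆ Eᶜ := connectedComponentIn_subset _ _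
  have hCo : IsOpen C := hE.isOpen_compl.connectedComponentIn
  have hC : IsPreconnected C := isPreconnected_connectedComponentIn
  obtain ⟨y, hyC, hy⟩ : (frontier C).Nonempty := by
    obtain ⟨z, hz⟩ := hne
    exact nonempty_frontier_iff.2 ⟨⟨x, hxC⟩, fun h => hCE (h ▸ mem_univ z) hz⟩
  refine ⟨y, by_contra fun hyE => hy ?_, hyC⟩
  have hsub : insert y C ⊆ C :=
    (hC.subset_closure (subset_insert _ _)
      (insert_subset hyC subset_closure)).subset_connectedComponentIn
      (mem_insert_of_mem _ hxC) (insert_subset hyE hCE)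
  exact hCo.interior_eq.symm ▸ hsub (mem_insert _ _)

theorem leftInverse_iterate_symm {X : Type*} [TopologicalSpace X] (F : X ≃ₜ X) (i : ℕ) :
    Function.LeftInverse (F.symm^[i]) (F^[i]) :=
  Function.LeftInverse.iterate F.symm_apply_apply i

/-- The union `E` of the first `n` preimages of `G` is spanning: up to time `n` the complementary
components of `E` never meet `G`, so they stay small, and each of them has a boundary point in
`E`. -/
theorem exists_isSpanningSet_card_le_mul {X : Type*} [MetricSpace X] [PreconnectedSpace X]
    [LocallyConnectedSpace X] (F : X ≃ₜ X) {G : Finset X} (hG : G.Nonempty) {δ ε : ℝ}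
    (hδ : 0 ≤ δ) (hδε : δ < ε)
    (hGδ : ∀ C, IsPreconnected C → Disjoint C (G : Set X) → ∀ x ∈ C, ∀ y ∈ C, dist x y ≤ δ)
    (n : ℕ+) : ∃ E : Finset X, E.card ≤ n * G.card ∧ IsSpanningSet F n ε (E : Set X) := by
  classical
  let E : Finset X := (Finset.range n).biUnion fun i => G.image (F.symm^[i])
  have hE : ∀ i < (n : ℕ), ∀ x, F^[i] x ∈ G → x ∈ E := fun i hi x hx =>
    Finset.mem_biUnion.2 ⟨i, Finset.mem_range.2 hi,
      Finset.mem_image.2 ⟨_, hx, leftInverse_iterate_symm F i x⟩⟩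
  have hEcard : E.card ≤ n * G.card :=
    (Finset.card_biUnion_le_card_mul _ _ G.card fun i _ => Finset.card_image_le).trans_eq
      (by rw [Finset.card_range])
  have hEne : (E : Set X).Nonempty := hG.imp fun z hz => hE 0 n.pos z hz
  refine ⟨E, hEcard, fun x => ?_⟩
  by_cases hx : x ∈ (E : Set X)
  · exact ⟨x, hx, (dynDist_lt_iff ..).2 fun i _ => by simpa using hδ.trans_lt hδε⟩
  obtain ⟨y, hyE, hyC⟩ :=
    exists_mem_closure_connectedComponentIn_compl E.finite_toSet.isClosed hEne hx
  set C := connectedComponentIn (E : Set X)ᶜ x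
  refine ⟨y, hyE, (dynDist_lt_iff ..).2 fun i hi => ?_⟩
  have hFi : Continuous F^[i] := F.continuous.iterate i
  have hCG : Disjoint (F^[i] '' C) (G : Set X) := by
    refine disjoint_left.2 ?_
    rintro _ ⟨w, hw, rfl⟩ hwG
    exact connectedComponentIn_subset _ _ hw (hE i hi w hwG)
  have hball : C ⊆ F^[i] ⁻¹' Metric.closedBall (F^[i] x) δ := fun z hz =>
    hGδ _ (isPreconnected_connectedComponentIn.image _ hFi.continuousOn) hCG _
      (mem_image_of_mem _ hz) _ (mem_image_of_mem _ (mem_connectedComponentIn hx))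
  have hy := closure_minimal hball (Metric.isClosed_closedBall.preimage hFi) hyC
  exact (dist_comm _ _).trans_lt (lt_of_le_of_lt hy hδε)

theorem exists_circle_isSpanningSet_card_le_mul (F : Circle ≃ₜ Circle) {ε : ℝ} (hε : 0 < ε) :
    ∃ K : ℕ, ∀ n : ℕ+, ∃ E : Finset Circle,
      E.card ≤ n * K ∧ IsSpanningSet F n ε (E : Set Circle) := by
  have := ChartedSpace.locallyConnectedSpace (EuclideanSpace ℝ (Fin 1)) Circle
  obtain ⟨N, hN⟩ := exists_forall_dist_circleRound_lt (show 0 < ε / 3 by positivity)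
  have hG := finite_range_circleRound N
  have hsmall : ∀ C, IsPreconnected C → Disjoint C (range (circleRound N)) →
      ∀ x ∈ C, ∀ y ∈ C, dist x y ≤ 2 * (ε / 3) := fun C hC hCN x hx y hy => by
    have hxy := circleRound_eq_of_isPreconnected N hC hCN hx hy
    linarith [dist_triangle_left x y (circleRound N x), hN x, hxy ▸ hN y]
  refine ⟨hG.toFinset.card, exists_isSpanningSet_card_le_mul F ?_ ?_ ?_ (by rwa [hG.coe_toFinset])⟩
  · exact hG.toFinset_nonempty.2 (range_nonempty _)
  · positivity
  · linarith

/-! ## Empirical measures and discrepancy -/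

section Empirical

variable {ι Ω : Type*} [Fintype ι] [Nonempty ι] [MeasurableSpace Ω]

/-- The uniform probability measure `(1 / |ι|) ∑ᵢ δ_{x i}` on a finite family of points, counted
with multiplicity. -/
noncomputable def empiricalMeasure (x : ι → Ω) : ProbabilityMeasure Ω :=
  ⟨(Fintype.card ι : ℝ≥0∞)⁻¹ • ∑ i, Measure.dirac (x i), ⟨by
    simp [ENNReal.inv_mul_cancel (Nat.cast_ne_zero.2 Fintype.card_ne_zero)
      (ENNReal.natCast_ne_top _)]⟩⟩

theorem toMeasure_empiricalMeasure (x : ι → Ω) : (empiricalMeasure x : Measure Ω) =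
    (Fintype.card ι : ℝ≥0∞)⁻¹ • ∑ i, Measure.dirac (x i) := rfl

theorem map_empiricalMeasure {Ω' : Type*} [MeasurableSpace Ω'] (x : ι → Ω) {g : Ω → Ω'}
    (hg : Measurable g) : (empiricalMeasure x : Measure Ω).map g = empiricalMeasure (g ∘ x) := by
  simp only [toMeasure_empiricalMeasure, Measure.map_smul, Measure.map_finset_sum hg.aemeasurable,
    Measure.map_dirac' hg, Function.comp_apply]

theorem integral_empiricalMeasure (x : ι → Ω) {f : Ω → ℝ} (hf : StronglyMeasurable f) :
    ∫ z, f z ∂(empiricalMeasure x : Measure Ω) = (Fintype.card ι : ℝ)⁻¹ * ∑ i, f (x i) := by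
  rw [toMeasure_empiricalMeasure, integral_smul_measure, integral_finsetSum_measure]
  · simp [integral_dirac' _ _ hf]
  · exact fun i _ => integrable_dirac' hf (by simp)

theorem measureReal_empiricalMeasure (x : ι → Ω) {A : Set Ω} [DecidablePred (· ∈ A)]
    (hA : MeasurableSet A) : (empiricalMeasure x : Measure Ω).real A =
      (Fintype.card ι : ℝ)⁻¹ * (Finset.univ.filter fun i => x i ∈ A).card := by
  have h := integral_empiricalMeasure x (f := A.indicator fun _ => (1 : ℝ))
    (stronglyMeasurable_const.indicator hA)
  rw [integral_indicator_const _ hA, smul_eq_mul, mul_one] at h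
  simp [h, indicator_apply]

variable [TopologicalSpace Ω] [BorelSpace Ω]

theorem continuous_empiricalMeasure :
    Continuous (empiricalMeasure : (ι → Ω) → ProbabilityMeasure Ω) := by
  refine ProbabilityMeasure.continuous_iff_forall_continuous_integral.2 fun f => ?_
  simp_rw [integral_empiricalMeasure _ f.continuous.stronglyMeasurable]
  fun_prop

theorem iterate_measureInduced_empiricalMeasure (T : C(Ω, Ω)) (i : ℕ) (x : ι → Ω) :
    (measureInduced T)^[i] (empiricalMeasure x) = empiricalMeasure (T^[i] ∘ x) := by
  induction i with
  | zero => rfl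
  | succ i ih =>
    rw [Function.iterate_succ_apply', ih, Function.iterate_succ']
    exact Subtype.ext (map_empiricalMeasure _ T.continuous.measurable)

end Empirical

section Quantile

/-- `s` is a `c`-quantile of the measure `m` on the line. It need not be unique. The quantiles of a
measure at equally spaced levels are the points of its empirical approximation. -/
def IsQuantile (m : Measure ℝ) (c s : ℝ) : Prop :=
  m.real (Iio s) ≤ c ∧ c ≤ m.real (Iic s)

variable {m : Measure ℝ} [IsProbabilityMeasure m] {c s : ℝ}

variable (m) in
theorem exists_isQuantile (hc₀ : 0 < c) (hc₁ : c < 1) :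
    ∃ s, IsQuantile m c s := by
  set G := ProbabilityTheory.cdf m
  let S : Set ℝ := {t | c ≤ G t}
  have hne : S.Nonempty :=
    ((ProbabilityTheory.tendsto_cdf_atTop m).eventually_const_le hc₁).exists
  have hbdd : BddBelow S := by
    obtain ⟨b, hb⟩ := ((ProbabilityTheory.tendsto_cdf_atBot m).eventually_lt_const hc₀).exists
    exact ⟨b, fun t ht => (G.mono.reflect_lt (hb.trans_le ht)).le⟩
  refine ⟨sInf S, ?_, ?_⟩
  · have hm : m (Iio (sInf S)) = ENNReal.ofReal (Function.leftLim G (sInf S) - 0) := by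
      rw [← StieltjesFunction.measure_Iio _ (ProbabilityTheory.tendsto_cdf_atBot m),
        ProbabilityTheory.measure_cdf]
    rw [Measure.real, hm, sub_zero, ENNReal.toReal_ofReal']
    refine max_le (le_of_tendsto (G.mono.tendsto_leftLim _) ?_) hc₀.le
    exact eventually_mem_nhdsWithin.mono fun t ht =>
      (not_le.1 fun h => notMem_of_lt_csInf ht hbdd h).le
  · rw [← ProbabilityTheory.cdf_eq_real]
    refine ge_of_tendsto ((G.right_continuous _).mono Ioi_subset_Ici_self) ?_
    refine eventually_mem_nhdsWithin.mono fun t ht => ?_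
    obtain ⟨u, hu, hut⟩ := exists_lt_of_csInf_lt hne ht
    exact le_trans hu (G.mono hut.le)

namespace IsQuantile

theorem le_measureReal (hs : IsQuantile m c s) {L : Set ℝ} (hL : IsLowerSet L) (hsL : s ∈ L) :
    c ≤ m.real L :=
  hs.2.trans (measureReal_mono (hL.Iic_subset hsL))

theorem measureReal_le (hs : IsQuantile m c s) {L : Set ℝ} (hL : IsLowerSet L) (hsL : s ∉ L) :
    m.real L ≤ c :=
  (measureReal_mono fun _ ht => not_le.1 fun hst => hsL (hL hst ht)).trans hs.1

theorem mem_Ioc (hs : IsQuantile m c s) (hc₀ : 0 < c) (hc₁ : c < 1) {a b : ℝ}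
    (hab : m.real (Ioc a b) = 1) : s ∈ Ioc a b := by
  refine ⟨not_le.1 fun hsa => ?_, not_lt.1 fun hbs => ?_⟩
  · have hIoc : m.real (Ioc a b) ≤ m.real (Ioi a) := measureReal_mono Ioc_subset_Ioi_self
    have := hs.le_measureReal (isLowerSet_Iic a) hsa
    rw [← compl_Iic, probReal_compl_eq_one_sub measurableSet_Iic] at hIoc
    linarith
  · have hIoc : m.real (Ioc a b) ≤ m.real (Iic b) := measureReal_mono Ioc_subset_Iic_self
    linarith [hs.measureReal_le (isLowerSet_Iic b) (not_le.2 hbs)]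

end IsQuantile

theorem abs_sub_card_le_half {M : ℕ} {J : Finset (Fin M)} {p : ℝ} (hp₀ : 0 ≤ p) (hpM : p ≤ M)
    (hJ : ∀ j ∈ J, (j : ℝ) + 1 / 2 ≤ p) (hJc : ∀ j ∉ J, p ≤ j + 1 / 2) :
    |p - J.card| ≤ 1 / 2 := by
  rw [abs_le]
  constructor
  · rcases Nat.eq_zero_or_pos J.card with h0 | h0
    · rw [h0, Nat.cast_zero]
      linarith
    have hlt : J.card - 1 < M := by grind [J.card_le_univ, Fintype.card_fin M]
    obtain ⟨j, hjJ, hj⟩ := Finset.exists_mem_notMem_of_card_lt_card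
      (s := Finset.Iio ⟨J.card - 1, hlt⟩) (t := J) (by rw [Fin.card_Iio]; grind)
    have hj' : (J.card : ℝ) ≤ j + 1 := by
      simp only [Finset.mem_Iio, not_lt, Fin.le_def] at hj
      exact_mod_cast Nat.sub_le_iff_le_add.1 hj
    linarith [hJ j hjJ]
  · rcases (J.card_le_univ.trans_eq (Fintype.card_fin M)).eq_or_lt with hM | hM
    · rw [hM]
      linarith
    obtain ⟨j, hj, hjJ⟩ := Finset.exists_mem_notMem_of_card_lt_card
      (s := J) (t := Finset.Iic ⟨J.card, hM⟩) (by rw [Fin.card_Iic]; exact Nat.lt_succ_self _)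
    have hj' : (j : ℝ) ≤ J.card := by exact_mod_cast Finset.mem_Iic.1 hj
    linarith [hJc j hjJ]

theorem abs_measureReal_sub_empiricalMeasure_le {M : ℕ} [NeZero M] {s : Fin M → ℝ}
    (hs : ∀ j : Fin M, IsQuantile m ((j + 1 / 2) / M) (s j)) {L : Set ℝ} (hL : IsLowerSet L) :
    |m.real L - (empiricalMeasure s : Measure ℝ).real L| ≤ 1 / 2 / M := by
  classical
  have hM : (0 : ℝ) < M := Nat.cast_pos.2 (NeZero.pos M)
  have hcard : |M * m.real L - (Finset.univ.filter fun j => s j ∈ L).card| ≤ 1 / 2 := by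
    refine abs_sub_card_le_half (by positivity) (mul_le_of_le_one_right hM.le measureReal_le_one)
      (fun j hj => ?_) (fun j hj => ?_)
    · exact (div_le_iff₀' hM).1 ((hs j).le_measureReal hL (Finset.mem_filter.1 hj).2)
    · refine (le_div_iff₀' hM).1 ((hs j).measureReal_le hL fun hjL => hj ?_)
      exact Finset.mem_filter.2 ⟨Finset.mem_univ j, hjL⟩
  rw [measureReal_empiricalMeasure _ hL.ordConnected.measurableSet, Fintype.card_fin,
    le_div_iff₀ hM, ← abs_of_pos hM, ← abs_mul, abs_of_pos hM, sub_mul, mul_right_comm,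
    inv_mul_cancel₀ hM.ne', one_mul, mul_comm]
  exact hcard

/-- An interval `I` is the difference of the lower sets `lowerClosure I` and
`lowerClosure I \ I`. -/
theorem abs_measureReal_sub_le_of_ordConnected {μ ν : Measure ℝ} [IsFiniteMeasure μ]
    [IsFiniteMeasure ν] {c : ℝ} (h : ∀ L, IsLowerSet L → |μ.real L - ν.real L| ≤ c) {I : Set ℝ}
    (hI : I.OrdConnected) : |μ.real I - ν.real I| ≤ 2 * c := by
  let L : Set ℝ := lowerClosure I
  have hL : IsLowerSet L := (lowerClosure I).lower
  have hL' : IsLowerSet (L \ I) := by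
    rintro t u hut ⟨⟨a, haI, hta⟩, htI⟩
    exact ⟨hL hut ⟨a, haI, hta⟩, fun huI => htI (hI.out huI haI ⟨hut, hta⟩)⟩
  have hsplit : ∀ ρ : Measure ℝ, [IsFiniteMeasure ρ] → ρ.real (L \ I) = ρ.real L - ρ.real I :=
    fun ρ _ => measureReal_sdiff subset_lowerClosure hI.measurableSet
  have h₁ := abs_le.1 (h L hL)
  have h₂ := abs_le.1 (h _ hL')
  rw [hsplit μ, hsplit ν] at h₂
  exact abs_le.2 ⟨by linarith, by linarith⟩

end Quantile

section Discrepancy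

/-- The discrepancy of `μ` and `ν` over all biconnected sets is at most `η`. It controls the
distance of `μ` and `ν` and, unlike that distance, is not increased by homeomorphisms. -/
def DiscrepancyLE {X : Type*} [TopologicalSpace X] [MeasurableSpace X]
    (μ ν : ProbabilityMeasure X) (η : ℝ) : Prop :=
  ∀ A, IsBiconnected A → |(μ : Measure X).real A - (ν : Measure X).real A| ≤ η

theorem DiscrepancyLE.iterate_measureInduced {X : Type*} [TopologicalSpace X] [MeasurableSpace X]
    [BorelSpace X] {μ ν : ProbabilityMeasure X} {η : ℝ} (h : DiscrepancyLE μ ν η) (F : X ≃ₜ X)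
    (i : ℕ) : DiscrepancyLE ((measureInduced (F : C(X, X)))^[i] μ)
      ((measureInduced (F : C(X, X)))^[i] ν) η := by
  have hmap : ∀ (μ : ProbabilityMeasure X) (A : Set X),
      (measureInduced (F : C(X, X)) μ : Measure X).real A = (μ : Measure X).real (F ⁻¹' A) :=
    fun μ A => congrArg ENNReal.toReal (F.toMeasurableEquiv.map_apply A)
  induction i with
  | zero => exact h
  | succ i ih =>
    intro A hA
    rw [Function.iterate_succ_apply', Function.iterate_succ_apply', hmap, hmap]
    exact ih _ (hA.preimage F)

theorem exists_discrepancyLE_empiricalMeasure (μ : ProbabilityMeasure Circle) (M : ℕ) [NeZero M] :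
    ∃ x : Fin M → Circle, DiscrepancyLE μ (empiricalMeasure x) (1 / M) := by
  have hM : (0 : ℝ) < M := Nat.cast_pos.2 (NeZero.pos M)
  let m : Measure ℝ := (μ : Measure Circle).map circleArg
  have : IsProbabilityMeasure m :=
    Measure.isProbabilityMeasure_map measurable_circleArg.aemeasurable
  have hπ : m.real (Ioc (-Real.pi) Real.pi) = 1 := by
    rw [map_measureReal_apply measurable_circleArg measurableSet_Ioc,
      preimage_eq_univ_iff.2 (range_subset_iff.2 circleArg_mem_Ioc), probReal_univ]
  have hc₀ (j : Fin M) : 0 < ((j : ℝ) + 1 / 2) / M := by positivity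
  have hc₁ (j : Fin M) : ((j : ℝ) + 1 / 2) / M < 1 := by
    have : (j : ℝ) + 1 ≤ M := by exact_mod_cast j.2
    rw [div_lt_one hM]
    linarith
  choose s hs using fun j => exists_isQuantile m (hc₀ j) (hc₁ j)
  have hsx : circleArg ∘ Circle.exp ∘ s = s :=
    funext fun j => circleArg_exp ((hs j).mem_Ioc (hc₀ j) (hc₁ j) hπ)
  have hclose (I : Set ℝ) (hI : I.OrdConnected) :
      |(μ : Measure Circle).real (circleArg ⁻¹' I) -
        (empiricalMeasure (Circle.exp ∘ s) : Measure Circle).real (circleArg ⁻¹' I)| ≤ 1 / M := by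
    rw [← map_measureReal_apply measurable_circleArg hI.measurableSet,
      ← map_measureReal_apply measurable_circleArg hI.measurableSet,
      map_empiricalMeasure _ measurable_circleArg, hsx]
    exact (abs_measureReal_sub_le_of_ordConnected
      (fun L => abs_measureReal_sub_empiricalMeasure_le hs) hI).trans_eq (by ring)
  refine ⟨Circle.exp ∘ s, fun A hA => ?_⟩
  obtain ⟨I, hI, rfl | hIA⟩ := hA.exists_circleArg_preimage
  · exact hclose I hI
  · have := hclose I hI
    rwa [hIA, probReal_compl_eq_one_sub hA.measurableSet,
      probReal_compl_eq_one_sub hA.measurableSet, sub_sub_sub_cancel_left, abs_sub_comm] at this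

end Discrepancy

section SimpleFunc

variable {X Y : Type*} [MeasurableSpace X] (p : SimpleFunc X Y) (f : Y → ℝ)

theorem integral_comp_simpleFunc (μ : Measure X) [IsFiniteMeasure μ] :
    ∫ x, f (p x) ∂μ = ∑ w ∈ p.range, μ.real (p ⁻¹' {w}) * f w := by
  classical
  have hsum : (fun x => f (p x)) =
      fun x => ∑ w ∈ p.range, (p ⁻¹' {w}).indicator (fun _ => f w) x := by
    ext x
    simp [indicator_apply]
  rw [hsum, integral_finsetSum _ fun w _ =>
    (integrable_const _).indicator (p.measurableSet_fiber w)]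
  simp_rw [integral_indicator_const _ (p.measurableSet_fiber _), smul_eq_mul]

theorem abs_integral_comp_simpleFunc_sub_le {μ ν : Measure X} [IsFiniteMeasure μ]
    [IsFiniteMeasure ν] {η : ℝ} (h : ∀ w, |μ.real (p ⁻¹' {w}) - ν.real (p ⁻¹' {w})| ≤ η) :
    |∫ x, f (p x) ∂μ - ∫ x, f (p x) ∂ν| ≤ η * ∑ w ∈ p.range, |f w| := by
  rw [integral_comp_simpleFunc, integral_comp_simpleFunc, ← Finset.sum_sub_distrib, Finset.mul_sum]
  refine (Finset.abs_sum_le_sum_abs _ _).trans (Finset.sum_le_sum fun w _ => ?_)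
  rw [← sub_mul, abs_mul]
  gcongr
  exact h w

end SimpleFunc

theorem exists_forall_discrepancyLE_abs_integral_sub_lt {f : Circle → ℝ} (hf : Continuous f) {c : ℝ}
    (hc : 0 < c) : ∃ η > 0, ∀ μ ν : ProbabilityMeasure Circle, DiscrepancyLE μ ν η →
      |∫ z, f z ∂(μ : Measure Circle) - ∫ z, f z ∂(ν : Measure Circle)| < c := by
  obtain ⟨δ, hδ, hfδ⟩ := Metric.uniformContinuous_iff.1
    (CompactSpace.uniformContinuous_of_continuous hf) (c / 4) (by positivity)
  obtain ⟨N, hN⟩ := exists_forall_dist_circleRound_lt hδ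
  let p : SimpleFunc Circle Circle := ⟨circleRound N,
    fun w => (isBiconnected_circleRound_fiber N w).measurableSet, finite_range_circleRound N⟩
  have happrox (μ : ProbabilityMeasure Circle) :
      |∫ z, f (p z) ∂(μ : Measure Circle) - ∫ z, f z ∂(μ : Measure Circle)| ≤ c / 4 := by
    have hpint : Integrable (fun z => f (p z)) (μ : Measure Circle) :=
      (p.map f).integrable_of_isFiniteMeasure
    rw [← integral_sub hpint
      (hf.integrable_of_hasCompactSupport (HasCompactSupport.of_compactSpace f))]
    have hle (z : Circle) : ‖f (p z) - f z‖ ≤ c / 4 := (hfδ (hN z)).le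
    simpa using norm_integral_le_of_norm_le_const (μ := (μ : Measure Circle))
      (Eventually.of_forall hle)
  set S := ∑ w ∈ p.range, |f w|
  have hS : 0 < 4 * (S + 1) := by positivity
  refine ⟨c / (4 * (S + 1)), div_pos hc hS, fun μ ν hμν => ?_⟩
  have hp := abs_integral_comp_simpleFunc_sub_le p f
    fun w => hμν _ (isBiconnected_circleRound_fiber N w)
  have hSc : c / (4 * (S + 1)) * S ≤ c / 4 := by
    rw [div_mul_eq_mul_div, div_le_div_iff₀ hS four_pos]
    nlinarith
  have h₁ := abs_le.1 (happrox μ)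
  have h₂ := abs_le.1 (happrox ν)
  have h₃ := abs_le.1 (hp.trans hSc)
  exact abs_lt.2 ⟨by linarith, by linarith⟩

theorem tendsto_dist_zero_of_tendsto_integral_sub {Ω ι : Type*} [TopologicalSpace Ω]
    [MeasurableSpace Ω] [BorelSpace Ω] [HasOuterApproxClosed Ω]
    [CompactSpace (ProbabilityMeasure Ω)] (d : CompatibleMetric (ProbabilityMeasure Ω))
    {l : Filter ι} {μ ν : ι → ProbabilityMeasure Ω}
    (h : ∀ f : Ω →ᵇ ℝ, Tendsto
      (fun i => ∫ z, f z ∂(μ i : Measure Ω) - ∫ z, f z ∂(ν i : Measure Ω)) l (𝓝 0)) :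
    Tendsto (fun i => d.metric.dist (μ i) (ν i)) l (𝓝 0) := by
  let _ := d.toMetricSpace
  rw [tendsto_iff_ultrafilter]
  intro U hU
  have hμ : Tendsto μ U (𝓝 (U.map μ).lim) := (U.map μ).le_nhds_lim
  have hν : Tendsto ν U (𝓝 (U.map ν).lim) := (U.map ν).le_nhds_lim
  have hlim : (U.map μ).lim = (U.map ν).lim := by
    refine ProbabilityMeasure.toMeasure_injective
      (ext_of_forall_integral_eq_of_IsFiniteMeasure fun f => ?_)
    have hf := ProbabilityMeasure.continuous_integral_boundedContinuousFunction f
    have hsub := ((hf.tendsto _).comp hμ).sub ((hf.tendsto _).comp hν)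
    exact sub_eq_zero.1 (tendsto_nhds_unique hsub ((h f).mono_left hU))
  exact (dist_self (U.map ν).lim) ▸ (hlim ▸ hμ).dist hν

theorem exists_forall_discrepancyLE_dist_lt (d : CompatibleMetric (ProbabilityMeasure Circle))
    {ε : ℝ} (hε : 0 < ε) : ∃ η > 0, ∀ μ ν : ProbabilityMeasure Circle,
      DiscrepancyLE μ ν η → d.metric.dist μ ν < ε := by
  by_contra! h
  choose μ ν hμν hdist using fun n : ℕ => h (1 / (n + 1)) Nat.one_div_pos_of_nat
  have hlim : Tendsto (fun n => d.metric.dist (μ n) (ν n)) atTop (𝓝 0) := by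
    refine tendsto_dist_zero_of_tendsto_integral_sub d fun f => Metric.tendsto_nhds.2 fun c hc => ?_
    obtain ⟨η, hη, hf⟩ := exists_forall_discrepancyLE_abs_integral_sub_lt f.continuous hc
    filter_upwards [(tendsto_one_div_add_atTop_nhds_zero_nat (𝕜 := ℝ)).eventually_lt_const hη]
      with n hn
    rw [Real.dist_0_eq_abs]
    exact hf _ _ fun A hA => (hμν n A hA).trans hn.le
  obtain ⟨n, hn⟩ := (hlim.eventually_lt_const hε).exists
  exact (hdist n).not_gt hn

/-! ## Spanning numbers of the measure-induced map -/

section SpanNumber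

variable {X : Type*} [MetricSpace X] {n : ℕ+} {ε : ℝ}

theorem spanNumber_le_card {T : X → X} {E : Finset X} (hE : IsSpanningSet T n ε (E : Set X)) :
    spanNumber T n ε ≤ E.card :=
  Nat.sInf_le ⟨E, hE, rfl⟩

theorem card_le_spanNumber_of_separated [CompactSpace X] (T : C(X, X)) (hε : 0 < ε) {ι : Type*}
    [Fintype ι] (p : ι → X)
    (hp : ∀ i j, i ≠ j → ∃ m < (n : ℕ), 2 * ε ≤ dist (T^[m] (p i)) (T^[m] (p j))) :
    Fintype.card ι ≤ spanNumber T n ε := by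
  obtain ⟨E₀, hE₀⟩ := exists_spanningSet T n hε
  obtain ⟨E, hE, hcard⟩ := Nat.sInf_mem
    (s := {k | ∃ E : Finset X, IsSpanningSet T n ε (E : Set X) ∧ E.card = k}) ⟨_, E₀, hE₀, rfl⟩
  rw [spanNumber, ← hcard]
  choose y hyE hy using fun i => hE (p i)
  refine Finset.card_le_card_of_injOn (s := Finset.univ) y (fun i _ => hyE i) fun i _ j _ hij => ?_
  by_contra hne
  obtain ⟨m, hm, hle⟩ := hp i j hne
  have hi := (dynDist_lt_iff ..).1 (hy i) m hm
  have hj := (dynDist_lt_iff ..).1 (hy j) m hm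
  rw [hij] at hi
  linarith [dist_triangle_right (T^[m] (p i)) (T^[m] (p j)) (T^[m] (y j))]

end SpanNumber

section UpperBound

theorem spanNumber_measureInduced_le_card_pow {X : Type*} [MetricSpace X] [MeasurableSpace X]
    [BorelSpace X] (T : C(X, X)) (d : CompatibleMetric (ProbabilityMeasure X)) {M : ℕ} [NeZero M]
    {n : ℕ+} {δ ε₁ ε₂ : ℝ} (hδ : 0 < δ)
    (happrox : ∀ μ : ProbabilityMeasure X, ∃ x : Fin M → X, ∀ i,
      d.metric.dist ((measureInduced T)^[i] μ) (empiricalMeasure (T^[i] ∘ x)) < ε₁)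
    (hclose : ∀ x y : Fin M → X, dist x y < δ →
      d.metric.dist (empiricalMeasure x) (empiricalMeasure y) < ε₂)
    {E : Finset X} (hE : IsSpanningSet T n δ (E : Set X)) :
    letI := d.toMetricSpace
    spanNumber (measureInduced T) n (ε₁ + ε₂) ≤ E.card ^ M := by
  classical
  let _ := d.toMetricSpace
  let S : Finset (ProbabilityMeasure X) :=
    (Fintype.piFinset fun _ : Fin M => E).image empiricalMeasure
  have hS : IsSpanningSet (measureInduced T) n (ε₁ + ε₂) (S : Set _) := by
    intro μ
    obtain ⟨x, hx⟩ := happrox μ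
    choose y hyE hy using fun j => hE (x j)
    refine ⟨empiricalMeasure y, Finset.mem_coe.2 (Finset.mem_image_of_mem _
      (Fintype.mem_piFinset.2 hyE)), (dynDist_lt_iff ..).2 fun i hi => ?_⟩
    have hxy : dist (T^[i] ∘ x) (T^[i] ∘ y) < δ :=
      (dist_pi_lt_iff hδ).2 fun j => (dynDist_lt_iff ..).1 (hy j) i hi
    rw [iterate_measureInduced_empiricalMeasure]
    exact (dist_triangle _ _ _).trans_lt (add_lt_add (hx i) (hclose _ _ hxy))
  calc spanNumber (measureInduced T) n (ε₁ + ε₂) ≤ S.card := spanNumber_le_card hS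
    _ ≤ (Fintype.piFinset fun _ : Fin M => E).card := Finset.card_image_le
    _ = E.card ^ M := by simp

variable (F : Circle ≃ₜ Circle) (d : CompatibleMetric (ProbabilityMeasure Circle))

theorem exists_forall_dist_iterate_measureInduced_lt {ε : ℝ} (hε : 0 < ε) :
    ∃ N : ℕ, ∀ μ : ProbabilityMeasure Circle, ∃ x : Fin (N + 1) → Circle, ∀ i,
      d.metric.dist ((measureInduced (F : C(Circle, Circle)))^[i] μ)
        (empiricalMeasure (F^[i] ∘ x)) < ε := by
  obtain ⟨η, hη, hdist⟩ := exists_forall_discrepancyLE_dist_lt d hε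
  obtain ⟨N, hN⟩ := exists_nat_one_div_lt hη
  refine ⟨N, fun μ => ?_⟩
  obtain ⟨x, hx⟩ := exists_discrepancyLE_empiricalMeasure μ (N + 1)
  have hxη : DiscrepancyLE μ (empiricalMeasure x) η := fun A hA =>
    (hx A hA).trans (by exact_mod_cast hN.le)
  refine ⟨x, fun i => hdist _ _ ?_⟩
  have hi := hxη.iterate_measureInduced F i
  rwa [iterate_measureInduced_empiricalMeasure] at hi

theorem exists_spanNumber_measureInduced_le_pow {ε : ℝ} (hε : 0 < ε) :
    ∃ K M : ℕ, 0 < M ∧ ∀ n : ℕ+,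
      letI := d.toMetricSpace
      spanNumber (measureInduced (F : C(Circle, Circle))) n ε ≤ (n * K) ^ M := by
  obtain ⟨N, happrox⟩ := exists_forall_dist_iterate_measureInduced_lt F d (half_pos hε)
  obtain ⟨δ, hδ, hclose⟩ : ∃ δ > 0, ∀ x y : Fin (N + 1) → Circle, dist x y < δ →
      d.metric.dist (empiricalMeasure x) (empiricalMeasure y) < ε / 2 := by
    let _ := d.toMetricSpace
    have hcont : Continuous
        (empiricalMeasure : (Fin (N + 1) → Circle) → ProbabilityMeasure Circle) :=
      continuous_empiricalMeasure
    obtain ⟨δ, hδ, h⟩ := Metric.uniformContinuous_iff.1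
      (CompactSpace.uniformContinuous_of_continuous hcont) (ε / 2) (half_pos hε)
    exact ⟨δ, hδ, fun x y => @h x y⟩
  obtain ⟨K, hK⟩ := exists_circle_isSpanningSet_card_le_mul F hδ
  refine ⟨K, N + 1, N.succ_pos, fun n => ?_⟩
  obtain ⟨E, hEcard, hE⟩ := hK n
  have hspan := spanNumber_measureInduced_le_card_pow (F : C(Circle, Circle)) d hδ happrox hclose hE
  rw [add_halves] at hspan
  exact hspan.trans (Nat.pow_le_pow_left hEcard _)

end UpperBound

section LowerBound

theorem iterate_symm_notMem_of_wandering {X : Type*} [TopologicalSpace X] (F : X ≃ₜ X) {U : Set X}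
    (hU : ∀ n : ℕ, 0 < n → ¬(F^[n] '' U ∩ U).Nonempty) {x : X} (hx : x ∈ U) {i m : ℕ}
    (him : i ≠ m) : F^[i] (F.symm^[m] x) ∉ U := by
  have hinv (m : ℕ) : F^[m] (F.symm^[m] x) = x := leftInverse_iterate_symm F.symm m x
  intro h
  rcases him.lt_or_gt with hlt | hlt
  · refine hU (m - i) (by lia) ⟨x, ⟨_, h, ?_⟩, hx⟩
    rw [← Function.iterate_add_apply, Nat.sub_add_cancel hlt.le, hinv]
  · refine hU (i - m) (by lia) ⟨_, ⟨x, hx, ?_⟩, h⟩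
    rw [← hinv m, ← Function.iterate_add_apply, Nat.sub_add_cancel hlt.le, hinv]

theorem exists_boundedContinuousFunction_iterate_eq_ite {X : Type*} [TopologicalSpace X]
    [CompletelyRegularSpace X] (F : X ≃ₜ X) (hF : nonwanderingSet F ≠ univ) :
    ∃ (f : X →ᵇ ℝ) (y : ℕ → X), ∀ i m, f (F^[i] (y m)) = if m = i then 1 else 0 := by
  obtain ⟨x, hx⟩ := (ne_univ_iff_exists_notMem _).1 hF
  simp only [nonwanderingSet, mem_ofPred_eq, not_forall, not_exists, not_and] at hx
  obtain ⟨U, hU, hwand⟩ := hx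
  obtain ⟨V, hVU, hV, hxV⟩ := mem_nhds_iff.1 hU
  obtain ⟨g, hg, hgx, hgV⟩ :=
    CompletelyRegularSpace.completely_regular x Vᶜ hV.isClosed_compl (not_not.2 hxV)
  let f : X →ᵇ ℝ := BoundedContinuousFunction.ofNormedAddCommGroup (fun z => 1 - (g z : ℝ))
    (by fun_prop) 1 fun z => by
      rw [Real.norm_eq_abs, abs_of_nonneg (sub_nonneg.2 (g z).2.2)]
      linarith [(g z).2.1]
  refine ⟨f, fun m => F.symm^[m] x, fun i m => ?_⟩
  split_ifs with him
  · subst him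
    have hinv : F^[m] (F.symm^[m] x) = x := leftInverse_iterate_symm F.symm m x
    change 1 - (g (F^[m] (F.symm^[m] x)) : ℝ) = 1
    rw [hinv, hgx, Icc.coe_zero, sub_zero]
  · have hnot : F^[i] (F.symm^[m] x) ∉ V := fun h =>
      iterate_symm_notMem_of_wandering F hwand (hVU hxV) (Ne.symm him) (hVU h)
    change 1 - (g (F^[i] (F.symm^[m] x)) : ℝ) = 0
    rw [hgV hnot, Pi.one_apply, Icc.coe_one, sub_self]

theorem exists_sum_two_pow_ne {k : ℕ} {α : Type*} [DecidableEq α] {a b : Fin k → α} (hab : a ≠ b) :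
    ∃ j₀, ∑ j with a j = a j₀, 2 ^ (j : ℕ) ≠ ∑ j with b j = a j₀, 2 ^ (j : ℕ) := by
  obtain ⟨j₀, hj₀⟩ := Function.ne_iff.1 hab
  refine ⟨j₀, fun h => ?_⟩
  have hsum (s : Finset (Fin k)) : ∑ j ∈ s, 2 ^ (j : ℕ) = ∑ j ∈ s.map Fin.valEmbedding, 2 ^ j :=
    (Finset.sum_map s Fin.valEmbedding _).symm
  rw [hsum, hsum] at h
  have hfilter := Finset.map_injective _ (Finset.geomSum_injective le_rfl h)
  have hmem : j₀ ∈ Finset.univ.filter fun j => b j = a j₀ :=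
    hfilter ▸ Finset.mem_filter.2 ⟨Finset.mem_univ _, rfl⟩
  exact hj₀ (Finset.mem_filter.1 hmem).2.symm

/-- The empirical measure of a `k`-tuple of points whose `j`-th entry has multiplicity `2 ^ j`. By
uniqueness of binary expansions, the mass of a point determines at which indices it occurs. -/
noncomputable def binaryMeasure {X : Type*} [MeasurableSpace X] {k : ℕ} [NeZero k] (x : Fin k → X) :
    ProbabilityMeasure X :=
  have : Nonempty (Σ j : Fin k, Fin (2 ^ (j : ℕ))) := ⟨⟨0, 0⟩⟩
  empiricalMeasure fun p : Σ j : Fin k, Fin (2 ^ (j : ℕ)) => x p.1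

theorem iterate_measureInduced_binaryMeasure {X : Type*} [TopologicalSpace X] [MeasurableSpace X]
    [BorelSpace X] (T : C(X, X)) (i : ℕ) {k : ℕ} [NeZero k] (x : Fin k → X) :
    (measureInduced T)^[i] (binaryMeasure x) = binaryMeasure (T^[i] ∘ x) :=
  have : Nonempty (Σ j : Fin k, Fin (2 ^ (j : ℕ))) := ⟨⟨0, 0⟩⟩
  iterate_measureInduced_empiricalMeasure T i _

theorem integral_binaryMeasure {X : Type*} [MeasurableSpace X] {k : ℕ} [NeZero k] (x : Fin k → X)
    {f : X → ℝ} (hf : StronglyMeasurable f) : ∫ z, f z ∂(binaryMeasure x : Measure X) =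
      (∑ j : Fin k, 2 ^ (j : ℕ) : ℝ)⁻¹ * ∑ j : Fin k, 2 ^ (j : ℕ) * f (x j) := by
  have : Nonempty (Σ j : Fin k, Fin (2 ^ (j : ℕ))) := ⟨⟨0, 0⟩⟩
  refine (integral_empiricalMeasure _ hf).trans ?_
  simp [Fintype.sum_sigma]

/-- The points `y m` visit the support of `f` at time `m` only, so the binary measures of distinct
tuples of such points are told apart by `f` at some time. -/
theorem exists_inv_le_abs_integral_binaryMeasure_sub {X : Type*} [TopologicalSpace X]
    [MeasurableSpace X] [BorelSpace X] (T : C(X, X)) {f : X →ᵇ ℝ} {y : ℕ → X}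
    (hf : ∀ i m, f (T^[i] (y m)) = if m = i then 1 else 0) {k : ℕ} [NeZero k] {a b : Fin k → ℕ}
    (hab : a ≠ b) : ∃ j₀, (∑ j : Fin k, 2 ^ (j : ℕ) : ℝ)⁻¹ ≤
      |∫ z, f z ∂((measureInduced T)^[a j₀] (binaryMeasure (y ∘ a)) : Measure X) -
        ∫ z, f z ∂((measureInduced T)^[a j₀] (binaryMeasure (y ∘ b)) : Measure X)| := by
  obtain ⟨j₀, hj₀⟩ := exists_sum_two_pow_ne hab
  have hint (c : Fin k → ℕ) (i : ℕ) :
      ∫ z, f z ∂((measureInduced T)^[i] (binaryMeasure (y ∘ c)) : Measure X) =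
        (∑ j : Fin k, 2 ^ (j : ℕ) : ℝ)⁻¹ * (∑ j with c j = i, 2 ^ (j : ℕ) : ℕ) := by
    rw [iterate_measureInduced_binaryMeasure,
      integral_binaryMeasure _ f.continuous.stronglyMeasurable]
    simp [hf, Finset.sum_filter]
  refine ⟨j₀, ?_⟩
  rw [hint, hint, ← mul_sub, abs_mul, abs_of_pos (by positivity)]
  refine le_mul_of_one_le_right (by positivity) ?_
  exact_mod_cast Int.one_le_abs (sub_ne_zero.2 (Int.ofNat_inj.not.2 hj₀))

theorem exists_pow_le_spanNumber_measureInduced {X : Type*} [TopologicalSpace X]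
    [CompletelyRegularSpace X] [MeasurableSpace X] [BorelSpace X]
    [CompactSpace (ProbabilityMeasure X)] (F : X ≃ₜ X) (hF : nonwanderingSet F ≠ univ)
    (d : CompatibleMetric (ProbabilityMeasure X)) (k : ℕ) [NeZero k] :
    ∃ ε > 0, ∀ n : ℕ+, letI := d.toMetricSpace
      (n : ℕ) ^ k ≤ spanNumber (measureInduced (F : C(X, X))) n ε := by
  let _ := d.toMetricSpace
  obtain ⟨f, y, hf⟩ := exists_boundedContinuousFunction_iterate_eq_ite F hF
  obtain ⟨ε, hε, hclose⟩ := Metric.uniformContinuous_iff.1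
    (CompactSpace.uniformContinuous_of_continuous
      (ProbabilityMeasure.continuous_integral_boundedContinuousFunction f))
    (∑ j : Fin k, 2 ^ (j : ℕ) : ℝ)⁻¹ (by positivity)
  refine ⟨ε / 2, half_pos hε, fun n => ?_⟩
  have hcard := card_le_spanNumber_of_separated (n := n) (measureInduced (F : C(X, X)))
    (half_pos hε) (fun a : Fin k → Fin n => binaryMeasure fun j => y (a j)) fun a b hab => ?_
  · simpa using hcard
  have hab' : (fun j => (a j : ℕ)) ≠ fun j => (b j : ℕ) := fun h =>
    hab (funext fun j => Fin.ext (congrFun h j))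
  obtain ⟨j₀, hj₀⟩ := exists_inv_le_abs_integral_binaryMeasure_sub (F : C(X, X)) hf hab'
  refine ⟨a j₀, (a j₀).2, ?_⟩
  rw [mul_div_cancel₀ ε two_ne_zero]
  exact not_lt.1 fun hlt => hj₀.not_gt (hclose hlt)

end LowerBound

theorem principal_mk_le_sSup_polynomialOrders {a : GrowthSeq} {K M : ℕ} (hM : 0 < M)
    (h : ∀ n, a.toFun n ≤ ((n * K) ^ M : ℕ)) :
    DedekindCut.principal (GrowthOrder.mk a) ≤
      sSup (DedekindCut.principal '' polynomialOrders) := by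
  have hM' : (0 : ℝ) < M := Nat.cast_pos.2 hM
  refine le_trans ?_ (le_sSup ⟨_, ⟨M, hM', rfl⟩, rfl⟩)
  refine DedekindCut.principal_le_principal.2 ((GrowthOrder.mk_le_mk _ _).2
    ⟨(K : ℝ≥0) ^ M + 1, by positivity, fun n => ?_⟩)
  calc a.toFun n ≤ ((n * K) ^ M : ℕ) := h n
    _ = (K : ℝ≥0) ^ M * (n : ℝ≥0) ^ (M : ℝ) := by
      rw [NNReal.rpow_natCast]
      push_cast
      ring
    _ ≤ ((K : ℝ≥0) ^ M + 1) * (n : ℝ≥0) ^ (M : ℝ) := by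
      gcongr
      exact le_self_add

theorem mk_polySeq_le_mk {t : ℝ} (ht : 0 < t) {a : GrowthSeq}
    (h : ∀ n : ℕ+, ((n ^ ⌈t⌉₊ : ℕ) : ℝ≥0) ≤ a.toFun n) :
    GrowthOrder.mk (polySeq t ht) ≤ GrowthOrder.mk a := by
  refine (GrowthOrder.mk_le_mk _ _).2 ⟨1, one_pos, fun n => ?_⟩
  have hn : (1 : ℝ≥0) ≤ n := by exact_mod_cast (one_le : 1 ≤ n)
  calc (n : ℝ≥0) ^ t ≤ (n : ℝ≥0) ^ (⌈t⌉₊ : ℝ) :=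
        NNReal.rpow_le_rpow_of_exponent_le hn (Nat.le_ceil t)
    _ = ((n ^ ⌈t⌉₊ : ℕ) : ℝ≥0) := by rw [NNReal.rpow_natCast, Nat.cast_pow]
    _ ≤ 1 * a.toFun n := (h n).trans_eq (one_mul _).symm

theorem generalizedEntropyWith_measureInduced_le (F : Circle ≃ₜ Circle)
    (d : CompatibleMetric (ProbabilityMeasure Circle)) :
    generalizedEntropyWith d (measureInduced (F : C(Circle, Circle))) ≤
      sSup (DedekindCut.principal '' polynomialOrders) := by
  refine sSup_le ?_
  rintro _ ⟨_, ⟨ε, hε, rfl⟩, rfl⟩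
  obtain ⟨K, M, hM, h⟩ := exists_spanNumber_measureInduced_le_pow F d hε
  exact principal_mk_le_sSup_polynomialOrders hM fun n => Nat.cast_le.2 (h n)

theorem le_generalizedEntropyWith_measureInduced {X : Type*} [TopologicalSpace X]
    [CompletelyRegularSpace X] [MeasurableSpace X] [BorelSpace X]
    [CompactSpace (ProbabilityMeasure X)] (F : X ≃ₜ X) (hF : nonwanderingSet F ≠ univ)
    (d : CompatibleMetric (ProbabilityMeasure X)) :
    sSup (DedekindCut.principal '' polynomialOrders) ≤
      generalizedEntropyWith d (measureInduced (F : C(X, X))) := by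
  refine sSup_le ?_
  rintro _ ⟨_, ⟨t, ht, rfl⟩, rfl⟩
  have : NeZero ⌈t⌉₊ := ⟨(Nat.ceil_pos.2 ht).ne'⟩
  obtain ⟨ε, hε, h⟩ := exists_pow_le_spanNumber_measureInduced F hF d ⌈t⌉₊
  let _ := d.toMetricSpace
  refine le_trans ?_ (le_sSup ⟨_, ⟨ε, hε, rfl⟩, rfl⟩)
  exact DedekindCut.principal_le_principal.2 (mk_polySeq_le_mk ht fun n => Nat.cast_le.2 (h n))

theorem theorem4_general (F : Circle ≃ₜ Circle) (hF : nonwanderingSet F ≠ univ)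
    (d : CompatibleMetric (ProbabilityMeasure Circle)) :
    generalizedEntropyWith d (measureInduced (F : C(Circle, Circle))) =
      sSup (DedekindCut.principal '' polynomialOrders) :=
  (generalizedEntropyWith_measureInduced_le F d).antisymm
    (le_generalizedEntropyWith_measureInduced F hF d)

theorem infinite_circle : Infinite Circle := by
  have hinj : InjOn Circle.exp (Ioc (-Real.pi) Real.pi) := fun s hs t ht hst => by
    rw [← circleArg_exp hs, hst, circleArg_exp ht]
  have : Infinite (Ioc (-Real.pi) Real.pi) := (Ioc_infinite (by linarith [Real.pi_pos])).to_subtype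
  exact Infinite.of_injective _ hinj.injective

/-- For a Morse–Smale diffeomorphism `F` of the circle, the generalized entropy of the
measure-induced map, computed with any metric `d` inducing the weak topology on the space of Borel
probability measures, is the supremum of the polynomial orders of growth. -/
theorem theorem4 (r : ℕ∞ω) (hr : 1 ≤ r)
    (F : Diffeomorph (𝓡 1) (𝓡 1) Circle Circle r) (hF : IsMorseSmale F)
    (d : CompatibleMetric (ProbabilityMeasure Circle)) :
    generalizedEntropyWith d (measureInduced F.toCircleMap) =
      sSup (DedekindCut.principal '' polynomialOrders) :=
  have := infinite_circle
  theorem4_general F.toHomeomorph (fun h => infinite_univ (h ▸ hF.finite_nonwandering)) d
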